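/- Let $n\ge 1$. For $1\le k\le n$ let $s_k(z_1,\dots,z_n)=\sum_{1\le j_1<\dots<j_k\le n}z_{j_1}\cdots z_{j_k}$ be the elementary symmetric polynomials, and let $\Gamma_n=\{(s_1(z),\dots,s_n(z)) : z\in\overline{\mathbb D}^n\}\subset\mathbb C^n$ be the symmetrized $n$-disc ($\Gamma_0=\mathbb C^0$ is a single point). The distinguished boundary $b\Gamma_n$ is the Shilov boundary of the algebra of functions continuous on $\Gamma_n$ and analytic on its interior. A commuting $n$-tuple $(S_1,\dots,S_n)$ of bounded operators on a complex Hilbert space is a $\Gamma_n$-contraction if $\|p(S_1,\dots,S_n)\|\le\sup_{z\in\Gamma_n}|p(z)|$ for every $p\in\mathbb C[z_1,\dots,z_n]$; it is a $\Gamma_n$-unitary if all $S_i$ are normal and the joint spectrum $\sigma(S_1,\dots,S_n)$ is contained in $b\Gamma_n$. (Here $(z_1,\dots,z_n)\in\sigma(S_1,\dots,S_n)$ means that the operators $S_1-z_1I,\dots,S_n-z_nI$ generate a proper left ideal or a proper right ideal of the algebra of all bounded operators; for commuting normal operators the usual notions of joint spectrum coincide.) **Theorem.** Let $S_1,\dots,S_n$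 be commuting bounded operators on a complex Hilbert space $\mathcal H$. The following are equivalent: (i) $(S_1,\dots,S_n)$ is a $\Gamma_n$-unitary; (ii) $S_n^*S_n=I=S_nS_n^*$, $S_n^*S_i=S_{n-i}^*$ for $i=1,\dots,n-1$, and $(\gamma_1S_1,\dots,\gamma_{n-1}S_{n-1})$ is a $\Gamma_{n-1}$-contraction, where $\gamma_i=\frac{n-i}{n}$ for $i=1,\dots,n-1$; (iii) there exist commuting unitary operators $U_1,\dots,U_n$ on $\mathcal H$ such that $$S_i=\sum_{1\le k_1<\dots<k_i\le n}U_{k_1}\cdots U_{k_i}\qquad\text{for } i=1,\dots,n.$$ -/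

import Mathlib

namespace GammaN

/-- The symmetrization map `𝐬 : ℂⁿ → ℂⁿ`, `𝐬(z) = (s₁(z), …, sₙ(z))`, with `sₖ` the `k`-th elementary
symmetric polynomial. Tuples are indexed from `0`, so the entry `i : Fin n` is `s_{i+1}(z)`. -/
noncomputable def symmetrization (n : ℕ) (z : Fin n → ℂ) : Fin n → ℂ :=
  fun i => MvPolynomial.eval z (MvPolynomial.esymm (Fin n) ℂ (i + 1))

/-- The symmetrized `n`-disc: the image of the closed unit polydisc under the symmetrization map.
For `n = 0` this is the one-point space `ℂ⁰`. -/
def Gamma (n : ℕ) : Set (Fin n → ℂ) :=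
  symmetrization n '' {z | ∀ i, ‖z i‖ ≤ 1}

/-- `f` is continuous on `K` and analytic on the interior of `K`. -/
def InDiscAlgebra {n : ℕ} (K : Set (Fin n → ℂ)) (f : (Fin n → ℂ) → ℂ) : Prop :=
  ContinuousOn f K ∧ AnalyticOnNhd ℂ f (interior K)

/-- `E` is a closed boundary for the algebra of functions continuous on `K` and analytic on its
interior: a closed subset of `K` on which every such function is at least as large in modulus as it
is anywhere on `K`. -/
def IsClosedBoundary {n : ℕ} (K E : Set (Fin n → ℂ)) : Prop :=
  IsClosed E ∧ E ⊆ K ∧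
    ∀ f : (Fin n → ℂ) → ℂ, InDiscAlgebra K f → ∀ z ∈ K, ∃ w ∈ E, ‖f z‖ ≤ ‖f w‖

/-- The Shilov boundary of that algebra (for compact `K`): the intersection of all closed
boundaries, that is, the smallest closed boundary. -/
def shilovBoundary {n : ℕ} (K : Set (Fin n → ℂ)) : Set (Fin n → ℂ) :=
  ⋂₀ {E | IsClosedBoundary K E}

/-- The distinguished boundary `bΓₙ` of the symmetrized `n`-disc. -/
def distinguishedBoundary (n : ℕ) : Set (Fin n → ℂ) :=
  shilovBoundary (Gamma n)

section Operators

variable {H : Type*} [NormedAddCommGroup H] [InnerProductSpace ℂ H]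

/-- `p(S₁, …, Sₙ)` for a polynomial `p` in `n` variables and a tuple of operators. Each monomial is
evaluated as the product `S₁ ^ m₁ ⋯ Sₙ ^ mₙ` in this order; the order is immaterial for the commuting
tuples to which this is applied. -/
noncomputable def polyEval {n : ℕ} (S : Fin n → H →L[ℂ] H) (p : MvPolynomial (Fin n) ℂ) :
    H →L[ℂ] H :=
  ∑ m ∈ p.support, p.coeff m • (List.ofFn fun i => S i ^ m i).prod

/-- `(S₁, …, Sₙ)` is a `Γₙ`-contraction: the operators commute and `Γₙ` is a spectral set for them.
The supremum is a maximum, because `Γₙ` is compact and non-empty. -/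
def IsGammaContraction {n : ℕ} (S : Fin n → H →L[ℂ] H) : Prop :=
  (∀ i j, Commute (S i) (S j)) ∧
    ∀ p : MvPolynomial (Fin n) ℂ,
      ‖polyEval S p‖ ≤ sSup ((fun z => ‖MvPolynomial.eval z p‖) '' Gamma n)

/-- The joint (Harte) spectrum of a commuting tuple in the algebra of all bounded operators: the
points `z` for which the operators `Sᵢ - zᵢ` generate a proper left ideal or a proper right ideal.
For commuting normal operators it is the same set as the Taylor spectrum and as the Gelfand spectrum
`{(φ(S₁), …, φ(Sₙ))}`, with `φ` running over the characters of the C*-algebra they generate. -/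
def jointSpectrum {n : ℕ} (S : Fin n → H →L[ℂ] H) : Set (Fin n → ℂ) :=
  {z | (¬ ∃ A : Fin n → H →L[ℂ] H, ∑ i, A i * (S i - z i • 1) = 1) ∨
       (¬ ∃ B : Fin n → H →L[ℂ] H, ∑ i, (S i - z i • 1) * B i = 1)}

/-- `(S₁, …, Sₙ)` is a `Γₙ`-unitary: commuting normal operators with joint spectrum contained in the
distinguished boundary of `Γₙ`. -/
def IsGammaUnitary [CompleteSpace H] {n : ℕ} (S : Fin n → H →L[ℂ] H) : Prop :=
  (∀ i j, Commute (S i) (S j)) ∧ (∀ i, IsStarNormal (S i)) ∧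
    jointSpectrum S ⊆ distinguishedBoundary n

end Operators

end GammaN

/-!
Each of the three conditions makes the operators in play commute with one another and with one
another's adjoints: by Fuglede's theorem for normal operators and for unitaries, and in the second
condition by algebra with the unitary `Sₙ`. Such a family lies in a commutative von Neumann algebra,
its double commutant, and Gelfand duality turns it into a tuple `f` of continuous functions on a
compact space `Ω`, whose joint range is the joint spectrum (`exists_extremallyDisconnected_model`,
`jointSpectrum_eq_range`). The theorem then becomes a statement about the points of `ℂⁿ` that `f`
takes as values, apart from the passage from `S` to the unitaries `U`, which requires a choice of
roots.

The distinguished boundary is `𝐬(𝕋ⁿ)` (`distinguishedBoundary_eq`): the maximum principle shows that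
it is a boundary, and explicit peak functions show that every boundary contains it. Hence being a
`Γₙ`-unitary means that `f` takes its values in `𝐬(𝕋ⁿ)`. The space `Ω` is extremally disconnected,
hence projective among compact Hausdorff spaces by Gleason's theorem, so `f` lifts through `𝐬 : 𝕋ⁿ →
𝐬(𝕋ⁿ)` to a tuple of continuous unimodular functions (`exists_torus_lift`), whose images are the
required unitaries. This replaces a Borel section of `𝐬` and the Borel functional calculus.

The step from the unitaries `U` to the second condition is pointwise: a polynomial with unimodular
roots is self-inversive, and the `γᵢ sᵢ` are the coefficients of its normalized derivative, whose
roots lie in the closed disc by Gauss–Lucas (`gammaScale_mem_Gamma`). For the step from the second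
condition to the first, polynomial convexity of `Γₙ₋₁` (`mem_Gamma_of_norm_eval_le`) turns the norm
inequalities into the statement that the derivative has its roots in the closed disc, and a
self-inversive polynomial with this property has all its roots on the circle
(`mem_image_torus_of_selfInversive`, a theorem of Cohn).
-/

namespace GammaN

/-! ### The spectrum of a commutative von Neumann algebra is extremally disconnected -/

section Operators

variable {H : Type*} [NormedAddCommGroup H] [InnerProductSpace ℂ H] [CompleteSpace H]

/-- Gelfand spectra of commutative von Neumann algebras are Stonean. For `U` open, the projection
onto the closed span of the ranges of `Φ f`, with `f` vanishing off `U`, commutes with the commutant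
of `M`, hence lies in `M`, and the corresponding idempotent function is the indicator of
`closure U`. -/
theorem extremallyDisconnected_of_range_eq_vonNeumannAlgebra {Ω : Type*} [TopologicalSpace Ω]
    [CompactSpace Ω] [T2Space Ω] (Φ : C(Ω, ℂ) →⋆ₐ[ℂ] (H →L[ℂ] H))
    (hΦ : Function.Injective Φ) (M : VonNeumannAlgebra H) (hM : ∀ T, T ∈ M ↔ ∃ f, Φ f = T) :
    ExtremallyDisconnected Ω := by
  have urysohn : ∀ (x : Ω) (s : Set Ω), IsClosed s → x ∉ s →
      ∃ f : C(Ω, ℂ), f x = 1 ∧ ∀ y ∈ s, f y = 0 := by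
    intro x s hs hx
    obtain ⟨f, hf0, hf1, -⟩ := exists_continuous_zero_one_of_isClosed hs isClosed_singleton
      (Set.disjoint_singleton_right.2 hx)
    refine ⟨⟨fun y => (f y : ℂ), by fun_prop⟩, ?_, fun y hy => ?_⟩
    · simpa using hf1 rfl
    · simpa using hf0 hy
  refine ⟨fun U hU => ?_⟩
  let K : Submodule ℂ H :=
    (⨆ f : {f : C(Ω, ℂ) // ∀ x ∉ U, f x = 0}, (Φ f.1).range).topologicalClosure
  have hKc : IsClosed (K : Set H) := Submodule.isClosed_topologicalClosure _
  have : CompleteSpace K := hKc.completeSpace_coe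
  have hsub : ∀ f : C(Ω, ℂ), (∀ x ∉ U, f x = 0) → ∀ v, Φ f v ∈ K := fun f hf v =>
    Submodule.le_topologicalClosure _
      (Submodule.mem_iSup_of_mem (⟨f, hf⟩ : {f : C(Ω, ℂ) // ∀ x ∉ U, f x = 0}) ⟨v, rfl⟩)
  -- An operator sends `K` into a closed subspace as soon as it does so on the generators of `K`.
  have hmin : ∀ (T : H →L[ℂ] H) (L : Submodule ℂ H), IsClosed (L : Set H) →
      (∀ f : C(Ω, ℂ), (∀ x ∉ U, f x = 0) → ∀ v, T (Φ f v) ∈ L) → ∀ v ∈ K, T v ∈ L := by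
    intro T L hL h
    have : K ≤ L.comap (T : H →ₗ[ℂ] H) := by
      refine Submodule.topologicalClosure_minimal _ (iSup_le ?_) (hL.preimage T.continuous)
      rintro ⟨f, hf⟩ _ ⟨v, rfl⟩
      exact h f hf v
    exact fun v hv => this hv
  have hP : K.starProjection ∈ M := by
    refine (VonNeumannAlgebra.IsStarProjection.mem_iff isStarProjection_starProjection M).2
      fun T hT => ?_
    rw [Submodule.range_starProjection, Module.End.mem_invtSubmodule]
    refine fun v hv => hmin T K hKc (fun f hf v => ?_) v hv
    have hcomm := VonNeumannAlgebra.mem_commutant_iff.1 hT (Φ f) ((hM _).2 ⟨f, rfl⟩)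
    have := congrArg (fun S : H →L[ℂ] H => S v) hcomm
    change Φ f (T v) = T (Φ f v) at this
    rw [← this]
    exact hsub f hf _
  obtain ⟨p, hp⟩ := (hM _).1 hP
  have hpp : p * p = p := hΦ <| by
    rw [map_mul, hp]
    exact isStarProjection_starProjection.isIdempotentElem
  have hp01 : ∀ x, p x = 0 ∨ p x = 1 := fun x => by
    have := congrArg (fun f : C(Ω, ℂ) => f x) hpp
    simp only [ContinuousMap.mul_apply] at this
    by_cases h0 : p x = 0
    · exact Or.inl h0
    · exact Or.inr ((mul_eq_right₀ h0).1 this)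
  have hpf : ∀ f : C(Ω, ℂ), (∀ x ∉ U, f x = 0) → p * f = f := fun f hf => hΦ <| by
    rw [map_mul, hp]
    ext v
    exact Submodule.starProjection_eq_self_iff.2 (hsub f hf v)
  have hclosure : closure U = {x | p x ≠ 0} := by
    refine Set.Subset.antisymm ?_ fun x hx => ?_
    · have : {x | p x ≠ 0} = {x | p x = 1} := by
        ext x
        rcases hp01 x with h | h <;> simp [h]
      rw [this]
      refine closure_minimal (fun x hx => ?_) (isClosed_eq p.continuous continuous_const)
      obtain ⟨f, hf1, hf0⟩ := urysohn x Uᶜ hU.isClosed_compl (by simpa using hx)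
      have := congrArg (fun f : C(Ω, ℂ) => f x) (hpf f hf0)
      simpa [hf1] using this
    · -- A function `g` vanishing on `closure U` kills every generator of `K`, so `g * p = 0`.
      by_contra hxU
      obtain ⟨g, hg1, hg0⟩ := urysohn x (closure U) isClosed_closure hxU
      have hgp : g * p = 0 := hΦ <| by
        rw [map_mul, hp, map_zero]
        ext v
        refine (Submodule.mem_bot ℂ).1 (hmin (Φ g) ⊥ isClosed_singleton (fun f hf v => ?_) _
          (Submodule.starProjection_apply_mem K v))
        have hgf : g * f = 0 := by
          ext y
          by_cases hy : y ∈ U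
          · simp [hg0 y (subset_closure hy)]
          · simp [hf y hy]
        have := congrArg (fun S : H →L[ℂ] H => S v) (congrArg Φ hgf)
        simpa using this
      have := congrArg (fun f : C(Ω, ℂ) => f x) hgp
      simp [hg1] at this
      exact hx this
  rw [hclosure]
  exact isOpen_ne_fun p.continuous continuous_const

end Operators

/-! ### Functional models and the joint spectrum -/

section Operators

universe u

/-- Functional model: operators that commute with one another and with one another's adjoints are
the images of continuous functions on a Stonean space under an isometric `*`-representation, namely
the inverse of the Gelfand transform on the double commutant of the family. -/
theorem exists_extremallyDisconnected_model {H : Type u} [NormedAddCommGroup H]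
    [InnerProductSpace ℂ H] [CompleteSpace H] {ι : Type*} (S : ι → H →L[ℂ] H)
    (hcomm : ∀ i j, Commute (S i) (S j)) (hstar : ∀ i j, Commute (S i) (star (S j))) :
    ∃ (Ω : Type u) (_ : TopologicalSpace Ω) (_ : CompactSpace Ω) (_ : T2Space Ω)
      (_ : ExtremallyDisconnected Ω) (Φ : C(Ω, ℂ) →⋆ₐ[ℂ] (H →L[ℂ] H)) (f : ι → C(Ω, ℂ)),
      (∀ g, ‖Φ g‖ = ‖g‖) ∧ ∀ i, Φ (f i) = S i := by
  let s : Set (H →L[ℂ] H) := Set.range S ∪ star (Set.range S)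
  have hs : ∀ a ∈ s, ∀ b ∈ s, a * b = b * a := by
    refine fun a ha b hb => Set.union_star_self_comm ?_ ?_ b hb a ha
    · rintro _ ⟨i, rfl⟩ _ ⟨j, rfl⟩
      exact hcomm j i
    · rintro _ ⟨i, rfl⟩ _ ⟨j, rfl⟩
      exact hstar j i
  let D : StarSubalgebra ℂ (H →L[ℂ] H) :=
    StarSubalgebra.centralizer ℂ (StarSubalgebra.centralizer ℂ (Set.range S) : Set (H →L[ℂ] H))
  have hD : (D : Set (H →L[ℂ] H)) = s.centralizer.centralizer :=
    StarSubalgebra.coe_centralizer_centralizer ℂ _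
  let M : VonNeumannAlgebra H :=
    { D with
      centralizer_centralizer' := by
        change (D : Set (H →L[ℂ] H)).centralizer.centralizer = (D : Set (H →L[ℂ] H))
        rw [hD]
        simp }
  let A := M.toStarSubalgebra
  have hA : (A : Set (H →L[ℂ] H)) = s.centralizer.centralizer := hD
  have hAclosed : IsClosed (A : Set (H →L[ℂ] H)) := by
    rw [hA]
    exact Set.isClosed_centralizer _
  let _ : CommCStarAlgebra A :=
    { StarSubalgebra.cstarAlgebra A with
      mul_comm := fun a b => Subtype.ext <|
        Set.centralizer_centralizer_comm_of_comm hs _ (hA ▸ a.2) _ (hA ▸ b.2) }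
  let G := gelfandStarTransform A
  let Φ : C(WeakDual.characterSpace ℂ A, ℂ) →⋆ₐ[ℂ] (H →L[ℂ] H) :=
    A.subtype.comp (G.symm : C(WeakDual.characterSpace ℂ A, ℂ) →⋆ₐ[ℂ] A)
  have hΦ : ∀ g, Φ g = (G.symm g : H →L[ℂ] H) := fun _ => rfl
  have hnorm : ∀ g, ‖Φ g‖ = ‖g‖ := by
    intro g
    have := (gelfandTransform_isometry A).norm_map_of_map_zero (map_zero _) (G.symm g)
    rw [hΦ]
    change ‖G.symm g‖ = _
    rw [← this]
    change ‖G (G.symm g)‖ = _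
    rw [StarAlgEquiv.apply_symm_apply]
  have hmem : ∀ i, S i ∈ A := fun i => by
    change S i ∈ (A : Set (H →L[ℂ] H))
    rw [hA]
    exact Set.subset_centralizer_centralizer (Or.inl ⟨i, rfl⟩)
  have hinj : Function.Injective Φ := fun a b h => by
    rw [← sub_eq_zero, ← norm_eq_zero, ← hnorm, map_sub, h, sub_self, norm_zero]
  refine ⟨WeakDual.characterSpace ℂ A, inferInstance, inferInstance, inferInstance,
    extremallyDisconnected_of_range_eq_vonNeumannAlgebra Φ hinj M fun T => ⟨fun hT => ?_, ?_⟩,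
    Φ, fun i => G ⟨S i, hmem i⟩, hnorm, fun i => ?_⟩
  · exact ⟨G ⟨T, hT⟩, by rw [hΦ, StarAlgEquiv.symm_apply_apply]⟩
  · rintro ⟨f, rfl⟩
    exact (G.symm f).2
  · rw [hΦ, StarAlgEquiv.symm_apply_apply]

section Model

variable {H : Type*} [NormedAddCommGroup H] [InnerProductSpace ℂ H] {n : ℕ}

theorem polyEval_map {R : Type*} [CommSemiring R] [Algebra ℂ R] (Φ : R →ₐ[ℂ] (H →L[ℂ] H))
    (f : Fin n → R) (p : MvPolynomial (Fin n) ℂ) :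
    polyEval (fun i => Φ (f i)) p = Φ (MvPolynomial.aeval f p) := by
  rw [MvPolynomial.aeval_def, MvPolynomial.eval₂_eq', map_sum, polyEval]
  refine Finset.sum_congr rfl fun m _ => ?_
  rw [← Algebra.smul_def, map_smul, ← List.prod_ofFn, map_list_prod, List.map_ofFn]
  simp [Function.comp_def]

theorem aeval_continuousMap_apply {Ω : Type*} [TopologicalSpace Ω] (f : Fin n → C(Ω, ℂ))
    (p : MvPolynomial (Fin n) ℂ) (x : Ω) :
    MvPolynomial.aeval f p x = MvPolynomial.eval (fun i => f i x) p := by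
  have : (MvPolynomial.aeval f p) x = ContinuousMap.evalAlgHom ℂ ℂ x (MvPolynomial.aeval f p) := rfl
  rw [this, ← AlgHom.comp_apply, MvPolynomial.comp_aeval]
  rfl

variable [CompleteSpace H]

/-- In a functional model the Harte spectrum is the joint range of the model functions. Off the range
`∑ |fᵢ - zᵢ|²` is invertible; at a point `x` of the range a function peaking near `x` shows that the
operators `Φ (fᵢ - fᵢ x)` generate no left ideal containing `1`. -/
theorem jointSpectrum_eq_range {Ω : Type*} [TopologicalSpace Ω] [CompactSpace Ω]
    (Φ : C(Ω, ℂ) →⋆ₐ[ℂ] (H →L[ℂ] H)) (hΦ : ∀ g, ‖Φ g‖ = ‖g‖) (f : Fin n → C(Ω, ℂ)) :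
    jointSpectrum (fun i => Φ (f i)) = Set.range fun x i => f i x := by
  have hsub : ∀ (z : Fin n → ℂ) i, Φ (f i) - z i • 1 = Φ (f i - z i • 1) := fun z i => by
    rw [map_sub, map_smul, map_one]
  ext z
  simp only [jointSpectrum, Set.mem_ofPred_eq, hsub]
  constructor
  · intro hz
    by_contra hrange
    let T : C(Ω, ℂ) := ∑ i, star (f i - z i • 1) * (f i - z i • 1)
    have hT : ∀ x, T x = ((∑ i, ‖f i x - z i‖ ^ 2 : ℝ) : ℂ) := fun x => by
      simp [T, ContinuousMap.sum_apply, Complex.conj_mul', ← map_sub]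
    have hne : ∀ x, T x ≠ 0 := fun x h => by
      rw [hT, Complex.ofReal_eq_zero, Finset.sum_eq_zero_iff_of_nonneg fun _ _ => sq_nonneg _] at h
      refine hrange ⟨x, funext fun i => ?_⟩
      simpa [sub_eq_zero] using h i (Finset.mem_univ i)
    let R : C(Ω, ℂ) := ⟨fun x => (T x)⁻¹, T.continuous.inv₀ hne⟩
    have hRT : R * T = 1 := by
      ext x
      exact inv_mul_cancel₀ (hne x)
    have key : ∑ i, (R * star (f i - z i • 1)) * (f i - z i • 1) = 1 := by
      simp only [mul_assoc, ← Finset.mul_sum]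
      exact hRT
    rcases hz with hz | hz
    · refine hz ⟨fun i => Φ (R * star (f i - z i • 1)), ?_⟩
      simp only [← map_mul, ← map_sum, key, map_one]
    · refine hz ⟨fun i => Φ (R * star (f i - z i • 1)), ?_⟩
      simp only [← map_mul, ← map_sum, mul_comm (f _ - z _ • 1), key, map_one]
  · rintro ⟨x, rfl⟩
    refine Or.inl ?_
    rintro ⟨A, hA⟩
    let D : Ω → ℝ := fun y => ∑ i, ‖f i y - f i x‖
    have hD : Continuous D := by fun_prop
    -- If `∑ A i * Φ (f i - f i x) = 1`, then `‖h‖ ≤ (∑ ‖A i‖) ε` for every `h` supported in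
    -- `{D < ε}`.
    obtain ⟨ε, hε, hAε⟩ : ∃ ε : ℝ, 0 < ε ∧ (∑ i, ‖A i‖) * ε < 1 := by
      refine ⟨(∑ i, ‖A i‖ + 1)⁻¹, by positivity, ?_⟩
      rw [← div_eq_mul_inv, div_lt_one (by positivity)]
      linarith
    let h : C(Ω, ℂ) := ⟨fun y => ((max 0 (1 - D y / ε) : ℝ) : ℂ), by fun_prop⟩
    have hhx : h x = 1 := by simp [h, D]
    have hh1 : 1 ≤ ‖h‖ := by
      have := h.norm_coe_le_norm x
      rwa [hhx, norm_one] at this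
    have hfh : ∀ i, ‖(f i - f i x • 1) * h‖ ≤ ε := by
      intro i
      refine (ContinuousMap.norm_le _ hε.le).2 fun y => ?_
      have hDi : ‖f i y - f i x‖ ≤ D y :=
        Finset.single_le_sum (f := fun i => ‖f i y - f i x‖) (fun _ _ => norm_nonneg _)
          (Finset.mem_univ i)
      have hD0 : 0 ≤ D y := (norm_nonneg _).trans hDi
      have : ((f i - f i x • 1) * h) y = (f i y - f i x) * ((max 0 (1 - D y / ε) : ℝ) : ℂ) := by
        simp [h]
      rw [this, norm_mul, Complex.norm_real, Real.norm_of_nonneg (le_max_left _ _)]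
      rcases le_total (1 - D y / ε) 0 with h0 | h0
      · rw [max_eq_left h0, mul_zero]
        exact hε.le
      · rw [max_eq_right h0]
        have h1 : D y ≤ ε := by
          rw [sub_nonneg, div_le_one hε] at h0
          exact h0
        have h2 : 1 - D y / ε ≤ 1 := by
          have : 0 ≤ D y / ε := by positivity
          linarith
        calc ‖f i y - f i x‖ * (1 - D y / ε) ≤ ‖f i y - f i x‖ * 1 := by gcongr
          _ ≤ ε := by linarith
    have hΦh : Φ h = ∑ i, A i * Φ ((f i - f i x • 1) * h) := by
      rw [← one_mul (Φ h), ← hA, Finset.sum_mul]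
      exact Finset.sum_congr rfl fun i _ => by rw [map_mul, mul_assoc]
    have : ‖h‖ ≤ (∑ i, ‖A i‖) * ε := by
      rw [← hΦ h, hΦh, Finset.sum_mul]
      refine norm_sum_le_of_le _ fun i _ => (norm_mul_le _ _).trans ?_
      rw [hΦ]
      exact mul_le_mul_of_nonneg_left (hfh i) (norm_nonneg _)
    linarith

end Model
end Operators

/-! ### Vieta's formulas and the symmetrized polydisc -/

section Vieta

open Polynomial

variable {n : ℕ}

/-- The monic polynomial `Xⁿ + s₁ Xⁿ⁻¹ + ⋯ + sₙ`. The signs are chosen so that for `s = 𝐬(z)` it is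
`∏ (X + zⱼ)`, with roots `-zⱼ`. -/
noncomputable def rootPoly (s : Fin n → ℂ) : ℂ[X] :=
  X ^ n + ∑ i : Fin n, C (s i) * X ^ (n - 1 - i)

theorem rootPoly_symmetrization (z : Fin n → ℂ) :
    rootPoly (symmetrization n z) = ∏ j, (X + C (z j)) := by
  have h := Multiset.prod_X_add_C_eq_sum_esymm (Finset.univ.val.map z)
  rw [Multiset.map_map, Multiset.card_map, Finset.card_val, Finset.card_univ, Fintype.card_fin,
    Finset.sum_range_succ', ← Fin.sum_univ_eq_sum_range
      (fun i => C ((Finset.univ.val.map z).esymm (i + 1)) * X ^ (n - (i + 1)))] at h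
  rw [Finset.prod, ← Function.comp_def (fun a => X + C a), h, rootPoly, add_comm]
  congr 1
  · refine Finset.sum_congr rfl fun i _ => ?_
    rw [symmetrization, ← MvPolynomial.aeval_eq_eval, MvPolynomial.aeval_esymm_eq_multiset_esymm,
      Nat.sub_sub, add_comm 1]
  · rw [Multiset.esymm, Multiset.powersetCard_zero_left, Multiset.map_singleton,
      Multiset.sum_singleton, Multiset.prod_zero, C_1, one_mul, Nat.sub_zero]

theorem coeff_rootPoly (s : Fin n → ℂ) (i : Fin n) : (rootPoly s).coeff (n - 1 - i) = s i := by
  rw [rootPoly, coeff_add, coeff_X_pow, if_neg (by omega), finsetSum_coeff, zero_add,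
    Finset.sum_eq_single i]
  · simp
  · intro j _ hj
    rw [coeff_C_mul, coeff_X_pow, if_neg, mul_zero]
    have : (i : ℕ) ≠ j := fun h => hj (Fin.ext h.symm)
    omega
  · simp

theorem rootPoly_injective : Function.Injective (rootPoly (n := n)) := fun s t h => by
  ext i
  rw [← coeff_rootPoly s, h, coeff_rootPoly]

theorem symmetrization_eq_iff (z s : Fin n → ℂ) :
    symmetrization n z = s ↔ rootPoly s = ∏ j, (X + C (z j)) := by
  rw [← rootPoly_symmetrization]
  exact ⟨fun h => by rw [h], fun h => (rootPoly_injective h).symm⟩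

theorem degree_rootPoly_sum_lt (s : Fin n → ℂ) :
    (∑ i : Fin n, C (s i) * X ^ (n - 1 - i) : ℂ[X]).degree < n := by
  refine (degree_sum_le _ _).trans_lt ((Finset.sup_lt_iff (WithBot.bot_lt_coe n)).2 fun i _ => ?_)
  refine (degree_C_mul_X_pow_le _ _).trans_lt ?_
  have := i.2
  exact Nat.cast_lt.2 (by omega)

theorem monic_rootPoly (s : Fin n → ℂ) : (rootPoly s).Monic :=
  monic_X_pow_add (degree_rootPoly_sum_lt s)

theorem natDegree_rootPoly (s : Fin n → ℂ) : (rootPoly s).natDegree = n := by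
  refine natDegree_eq_of_degree_eq_some ?_
  rw [rootPoly, degree_add_eq_left_of_degree_lt] <;> rw [degree_X_pow]
  exact degree_rootPoly_sum_lt s

/-- Every monic polynomial of degree `n` over `ℂ` splits, so `𝐬` is onto `ℂⁿ`. -/
theorem symmetrization_surjective : Function.Surjective (symmetrization n) := fun s => by
  have h := (IsAlgClosed.splits (rootPoly s)).eq_prod_roots_of_monic (monic_rootPoly s)
  have hcard := (splits_iff_card_roots.1 (IsAlgClosed.splits (rootPoly s)))
  rw [natDegree_rootPoly] at hcard
  obtain ⟨l, hl⟩ := Quot.exists_rep (rootPoly s).roots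
  change (l : Multiset ℂ) = _ at hl
  rw [← hl] at h hcard
  rw [Multiset.coe_card] at hcard
  subst hcard
  refine ⟨fun i => -l[i], (symmetrization_eq_iff _ _).2 ?_⟩
  rw [h, Multiset.map_coe, Multiset.prod_coe]
  simp only [map_neg, ← sub_eq_add_neg]
  rw [← List.prod_ofFn]
  congr 1
  exact List.ext_get (by simp) (by simp)

theorem eval_rootPoly_symmetrization (z : Fin n → ℂ) (t : ℂ) :
    (rootPoly (symmetrization n z)).eval t = ∏ j, (t + z j) := by
  rw [rootPoly_symmetrization, eval_prod]
  simp

theorem eval_rootPoly (s : Fin n → ℂ) (t : ℂ) :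
    (rootPoly s).eval t = t ^ n + ∑ i : Fin n, s i * t ^ (n - 1 - i) := by
  simp [rootPoly, eval_finsetSum]

/-- The reversed form of Vieta's formula. -/
theorem prod_one_add_mul (z : Fin n → ℂ) (u : ℂ) :
    ∏ j, (1 + z j * u) = 1 + ∑ i, symmetrization n z i * u ^ (i + 1 : ℕ) := by
  rcases eq_or_ne u 0 with rfl | hu
  · simp
  have h1 : ∏ j, (1 + z j * u) = u ^ n * ∏ j, (u⁻¹ + z j) := by
    rw [← Fin.prod_const, ← Finset.prod_mul_distrib]
    refine Finset.prod_congr rfl fun j _ => ?_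
    rw [mul_add, mul_inv_cancel₀ hu, mul_comm u]
  rw [h1, ← eval_rootPoly_symmetrization, eval_rootPoly, mul_add, ← mul_pow, mul_inv_cancel₀ hu,
    one_pow, Finset.mul_sum]
  congr 1
  refine Finset.sum_congr rfl fun i _ => ?_
  have hn : u ^ n = u ^ (i + 1 : ℕ) * u ^ (n - 1 - i) := by
    rw [← pow_add]
    congr 1
    omega
  rw [hn, inv_pow]
  field_simp

/-- A symmetric polynomial descends along `𝐬` to a polynomial. -/
theorem eval_symmetric_eq {p : MvPolynomial (Fin n) ℂ} (hp : p.IsSymmetric) :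
    ∃ q : MvPolynomial (Fin n) ℂ, ∀ z, MvPolynomial.eval (symmetrization n z) q =
      MvPolynomial.eval z p := by
  obtain ⟨q, hq⟩ := MvPolynomial.esymmAlgHom_surjective (σ := Fin n) ℂ (n := n) (by simp) ⟨p, hp⟩
  refine ⟨q, fun z => ?_⟩
  have := congrArg Subtype.val hq
  rw [MvPolynomial.esymmAlgHom_apply] at this
  change _ = p at this
  rw [← this, ← MvPolynomial.aeval_eq_eval, ← MvPolynomial.aeval_eq_eval z,
    MvPolynomial.comp_aeval_apply]
  rfl

theorem symmetrization_comp_perm (z : Fin n → ℂ) (e : Equiv.Perm (Fin n)) :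
    symmetrization n (z ∘ e) = symmetrization n z := by
  rw [symmetrization_eq_iff, rootPoly_symmetrization]
  exact (Equiv.prod_comp e fun j => X + C (z j)).symm

theorem continuous_symmetrization : Continuous (symmetrization n) :=
  continuous_pi fun _ => MvPolynomial.continuous_eval _

end Vieta

section Gamma
variable {n : ℕ}

theorem isCompact_Gamma : IsCompact (Gamma n) := by
  have : {z : Fin n → ℂ | ∀ i, ‖z i‖ ≤ 1} = Set.univ.pi fun _ => Metric.closedBall 0 1 := by
    ext z
    simp
  rw [Gamma, this]
  exact (isCompact_univ_pi fun _ => isCompact_closedBall 0 1).image continuous_symmetrization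

/-- The unit torus `𝕋ⁿ`. -/
def torus (n : ℕ) : Set (Fin n → ℂ) := {z | ∀ i, ‖z i‖ = 1}

theorem isCompact_torus : IsCompact (torus n) := by
  have : torus n = Set.univ.pi fun _ => Metric.sphere 0 1 := by
    ext z
    simp [torus]
  rw [this]
  exact isCompact_univ_pi fun _ => isCompact_sphere 0 1

theorem symmetrization_mem_Gamma_iff (z : Fin n → ℂ) :
    symmetrization n z ∈ Gamma n ↔ ∀ i, ‖z i‖ ≤ 1 := by
  refine ⟨?_, fun h => ⟨z, h, rfl⟩⟩
  rintro ⟨w, hw, hwz⟩ i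
  have h := eval_rootPoly_symmetrization z (-z i)
  rw [← hwz, eval_rootPoly_symmetrization,
    Finset.prod_eq_zero (f := fun j => -z i + z j) (Finset.mem_univ i) (neg_add_cancel _),
    Finset.prod_eq_zero_iff] at h
  obtain ⟨j, -, hj⟩ := h
  have : z i = w j := by linear_combination -hj
  rw [this]
  exact hw j

/-- All `wⱼ` lie in the open disc exactly when `1 + s₁ u + ⋯ + sₙ uⁿ = ∏ (1 + wⱼ u)` has no zero in
the closed disc, and by compactness of the closed disc this is an open condition on `s`. -/
theorem symmetrization_mem_interior_Gamma {z : Fin n → ℂ} (hz : ∀ i, ‖z i‖ < 1) :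
    symmetrization n z ∈ interior (Gamma n) := by
  let F : (Fin n → ℂ) × ℂ → ℂ := fun p => 1 + ∑ i, p.1 i * p.2 ^ (i + 1 : ℕ)
  have hF : Continuous F := by fun_prop
  have hsub : ({symmetrization n z} : Set _) ×ˢ Metric.closedBall (0 : ℂ) 1 ⊆ {p | F p ≠ 0} := by
    rintro ⟨s, u⟩ ⟨rfl, hu⟩
    change _ + _ ≠ (0 : ℂ)
    rw [← prod_one_add_mul, Finset.prod_ne_zero_iff]
    intro j _ h
    have h1 : ‖z j * u‖ = 1 := by
      rw [show z j * u = -1 by linear_combination h, norm_neg, norm_one]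
    rw [norm_mul] at h1
    have h2 : ‖u‖ ≤ 1 := by simpa using hu
    nlinarith [hz j, norm_nonneg (z j), norm_nonneg u]
  obtain ⟨V, W, hV, -, hzV, hW, hVW⟩ := generalized_tube_lemma isCompact_singleton
    (isCompact_closedBall 0 1) (isOpen_ne_fun hF continuous_const) hsub
  refine mem_interior.2 ⟨V, fun s hs => ?_, hV, hzV rfl⟩
  obtain ⟨w, rfl⟩ := symmetrization_surjective s
  refine (symmetrization_mem_Gamma_iff w).2 fun j => ?_
  by_contra! hj
  have hwj : w j ≠ 0 := fun h => by
    rw [h, norm_zero] at hj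
    linarith
  have hmem : -(w j)⁻¹ ∈ Metric.closedBall (0 : ℂ) 1 := by
    simpa using inv_le_one_of_one_le₀ hj.le
  refine hVW (Set.mk_mem_prod hs (hW hmem)) ?_
  change _ + _ = (0 : ℂ)
  rw [← prod_one_add_mul, Finset.prod_eq_zero (Finset.mem_univ j)]
  field_simp
  ring

end Gamma

/-! ### The distinguished boundary -/

section Boundary

variable {n : ℕ}

/-- The maximum principle on the polydisc: apply the one-variable principle in each coordinate in
turn to move the point to the torus. -/
theorem exists_mem_torus_norm_le {g : (Fin n → ℂ) → ℂ} {V : Set (Fin n → ℂ)}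
    (hsub : ∀ z : Fin n → ℂ, (∀ i, ‖z i‖ ≤ 1) → z ∈ V) (hg : DifferentiableOn ℂ g V)
    (z : Fin n → ℂ) (hz : ∀ i, ‖z i‖ ≤ 1) : ∃ w ∈ torus n, ‖g z‖ ≤ ‖g w‖ := by
  suffices h : ∀ s : Finset (Fin n), ∃ w : Fin n → ℂ, (∀ i, ‖w i‖ ≤ 1) ∧ (∀ i ∈ s, ‖w i‖ = 1) ∧
      ‖g z‖ ≤ ‖g w‖ by
    obtain ⟨w, -, hw, hle⟩ := h Finset.univ
    exact ⟨w, fun i => hw i (Finset.mem_univ i), hle⟩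
  intro s
  induction s using Finset.induction_on with
  | empty => exact ⟨z, hz, by simp, le_rfl⟩
  | insert a s _ ih =>
    obtain ⟨w, hw, hws, hle⟩ := ih
    have hup : ∀ t : ℂ, ‖t‖ ≤ 1 → ∀ i, ‖Function.update w a t i‖ ≤ 1 := by
      intro t ht i
      rcases eq_or_ne i a with rfl | hi
      · simpa using ht
      · simpa [hi] using hw i
    have hd : DifferentiableOn ℂ (fun t => g (Function.update w a t)) (Metric.closedBall 0 1) := by
      refine hg.comp (fun t _ => ?_) fun t ht => hsub _ (hup t (by simpa using ht))
      exact (hasFDerivAt_update w t).differentiableAt.differentiableWithinAt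
    have hcl : closure (Metric.ball (0 : ℂ) 1) = Metric.closedBall 0 1 :=
      closure_ball 0 one_ne_zero
    obtain ⟨t, ht, hmax⟩ := Complex.exists_mem_frontier_isMaxOn_norm (Metric.isBounded_ball)
      (Metric.nonempty_ball.2 one_pos) (DifferentiableOn.diffContOnCl (hcl ▸ hd))
    rw [frontier_ball 0 one_ne_zero, mem_sphere_zero_iff_norm] at ht
    rw [hcl] at hmax
    refine ⟨Function.update w a t, hup t ht.le, fun i hi => ?_, hle.trans ?_⟩
    · rcases eq_or_ne i a with rfl | hia
      · simpa using ht
      · simpa [hia] using hws i (Finset.mem_of_mem_insert_of_ne hi hia)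
    · have := hmax (show w a ∈ _ by simpa using hw a)
      simpa using this

/-- The functions `z ↦ f (𝐬 (r z))` with `r < 1` extend holomorphically past the closed polydisc, so
they attain their maxima on the torus; let `r → 1`. -/
theorem torus_image_isClosedBoundary :
    IsClosedBoundary (Gamma n) (symmetrization n '' torus n) := by
  refine ⟨(isCompact_torus.image continuous_symmetrization).isClosed,
    Set.image_mono fun z hz i => (hz i).le, ?_⟩
  rintro f ⟨hc, ha⟩ _ ⟨z, hz, rfl⟩
  have hdisc : ∀ (r : ℝ) (w : Fin n → ℂ), 0 ≤ r → r ≤ 1 → (∀ i, ‖w i‖ ≤ 1) →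
      ∀ i, ‖((r : ℂ) • w) i‖ ≤ r := by
    intro r w hr hr1 hw i
    rw [Pi.smul_apply, norm_smul, Complex.norm_real, Real.norm_of_nonneg hr]
    exact mul_le_of_le_one_right hr (hw i)
  let r : ℕ → ℝ := fun k => 1 - 1 / (k + 2 : ℝ)
  have hr0 : ∀ k, 0 < r k := fun k => by
    have : 1 / (k + 2 : ℝ) < 1 := by
      rw [div_lt_one (by positivity)]
      linarith [Nat.cast_nonneg (α := ℝ) k]
    change 0 < 1 - 1 / (k + 2 : ℝ)
    linarith
  have hr1 : ∀ k, r k < 1 := fun k => by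
    have : 0 < 1 / (k + 2 : ℝ) := by positivity
    change 1 - 1 / (k + 2 : ℝ) < 1
    linarith
  have hrlim : Filter.Tendsto r Filter.atTop (nhds 1) := by
    have h : Filter.Tendsto (fun k : ℕ => 1 / (((k + 2 : ℕ) : ℝ))) Filter.atTop (nhds 0) :=
      (tendsto_one_div_atTop_nhds_zero_nat (𝕜 := ℝ)).comp (Filter.tendsto_add_atTop_nat 2)
    have := h.const_sub 1
    simpa [r] using this
  have step : ∀ k, ∃ w ∈ torus n, ‖f (symmetrization n ((r k : ℂ) • z))‖ ≤
      ‖f (symmetrization n ((r k : ℂ) • w))‖ := by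
    intro k
    refine exists_mem_torus_norm_le (g := fun w => f (symmetrization n ((r k : ℂ) • w)))
      (V := {w | ∀ i, ‖((r k : ℂ) • w) i‖ < 1})
      (fun w hw i => (hdisc _ w (hr0 k).le (hr1 k).le hw i).trans_lt (hr1 k)) ?_ z hz
    · intro w hw
      have h1 : DifferentiableAt ℂ f (symmetrization n ((r k : ℂ) • w)) :=
        (ha _ (symmetrization_mem_interior_Gamma hw)).differentiableAt
      have h2 : DifferentiableAt ℂ (fun w => symmetrization n ((r k : ℂ) • w)) w := by
        refine differentiableAt_pi.2 fun i => ?_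
        exact (AnalyticOnNhd.eval_mvPolynomial (MvPolynomial.esymm (Fin n) ℂ (i + 1)) _
          (Set.mem_univ _)).differentiableAt.comp w (by fun_prop)
      exact (h1.comp w h2).differentiableWithinAt
  choose w hwT hw using step
  obtain ⟨w', hw', φ, hφ, hlim⟩ := isCompact_torus.tendsto_subseq hwT
  refine ⟨_, ⟨w', hw', rfl⟩, ?_⟩
  have hrφ : Filter.Tendsto (fun k => (r (φ k) : ℂ)) Filter.atTop (nhds 1) := by
    have := (Complex.continuous_ofReal.tendsto 1).comp (hrlim.comp hφ.tendsto_atTop)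
    simpa [Function.comp_def] using this
  have hlimf : ∀ (v : ℕ → Fin n → ℂ) (v' : Fin n → ℂ), (∀ k i, ‖v k i‖ ≤ 1) →
      (∀ i, ‖v' i‖ ≤ 1) → Filter.Tendsto v Filter.atTop (nhds v') →
      Filter.Tendsto (fun k => ‖f (symmetrization n ((r (φ k) : ℂ) • v k))‖) Filter.atTop
        (nhds ‖f (symmetrization n v')‖) := by
    intro v v' hv hv' h
    have h1 : Filter.Tendsto (fun k => symmetrization n ((r (φ k) : ℂ) • v k)) Filter.atTop
        (nhds (symmetrization n v')) := by
      have := (continuous_symmetrization.tendsto ((1 : ℂ) • v')).comp (hrφ.smul h)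
      rwa [one_smul] at this
    refine ((hc _ ((symmetrization_mem_Gamma_iff v').2 hv')).tendsto.comp
      (tendsto_nhdsWithin_iff.2 ⟨h1, Filter.Eventually.of_forall fun k =>
        (symmetrization_mem_Gamma_iff _).2 fun i => ?_⟩)).norm
    exact (hdisc _ _ (hr0 _).le (hr1 _).le (hv k) i).trans (hr1 _).le
  exact le_of_tendsto_of_tendsto' (hlimf (fun _ => z) z (fun _ => hz) hz tendsto_const_nhds)
    (hlimf _ w' (fun k i => (hwT _ i).le) (fun i => (hw' i).le) hlim) fun k => hw _

end Boundary

section Peak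

open MvPolynomial

variable {n : ℕ}

/-- The affine function `(1 + ∑ āⱼ zⱼ) / (n + 1)`; for `a` in the torus its restriction to the closed
polydisc peaks at `a` only. The summand `1` and the denominator `n + 1` cover the case `n = 0`. -/
noncomputable def peakForm (a : Fin n → ℂ) : MvPolynomial (Fin n) ℂ :=
  C ((n + 1 : ℂ)⁻¹) * (1 + ∑ j, C (star (a j)) * X j)

theorem eq_one_of_norm_le_of_re_eq {w : ℂ} (hw : ‖w‖ ≤ 1) (h : w.re = 1) : w = 1 := by
  have h1 := Complex.sq_norm w
  rw [Complex.normSq_apply, h] at h1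
  have him : w.im = 0 := by nlinarith [norm_nonneg w, sq_nonneg w.im]
  exact Complex.ext (by simpa using h) (by simpa using him)

theorem eval_peakForm (a z : Fin n → ℂ) :
    eval z (peakForm a) = (n + 1 : ℂ)⁻¹ * (1 + ∑ j, star (a j) * z j) := by
  simp [peakForm]

theorem norm_star_mul_le_one {a z : Fin n → ℂ} (ha : a ∈ torus n) (hz : ∀ i, ‖z i‖ ≤ 1)
    (j : Fin n) : ‖star (a j) * z j‖ ≤ 1 := by
  rw [norm_mul, norm_star, ha j, one_mul]
  exact hz j

theorem norm_eval_peakForm_le_one {a z : Fin n → ℂ} (ha : a ∈ torus n) (hz : ∀ i, ‖z i‖ ≤ 1) :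
    ‖eval z (peakForm a)‖ ≤ 1 := by
  rw [eval_peakForm, norm_mul, norm_inv, show (n + 1 : ℂ) = ((n + 1 : ℝ) : ℂ) by push_cast; rfl,
    Complex.norm_real, Real.norm_of_nonneg (by positivity), inv_mul_le_iff₀ (by positivity),
    mul_one]
  calc ‖1 + ∑ j, star (a j) * z j‖ ≤ ‖(1 : ℂ)‖ + ∑ j : Fin n, (1 : ℝ) :=
        (norm_add_le _ _).trans (add_le_add le_rfl
          (norm_sum_le_of_le _ fun j _ => norm_star_mul_le_one ha hz j))
    _ = n + 1 := by simp [add_comm]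

theorem eq_of_eval_peakForm_eq_one {a z : Fin n → ℂ} (ha : a ∈ torus n) (hz : ∀ i, ‖z i‖ ≤ 1)
    (h : eval z (peakForm a) = 1) : z = a := by
  have hn : (n + 1 : ℂ) ≠ 0 := by exact_mod_cast n.succ_ne_zero
  rw [eval_peakForm, inv_mul_eq_iff_eq_mul₀ hn, mul_one] at h
  have hre : ∑ j, (1 - (star (a j) * z j).re) = 0 := by
    have := congrArg Complex.re h
    simp only [Complex.add_re, Complex.one_re, Complex.re_sum, Complex.natCast_re] at this
    rw [Finset.sum_sub_distrib]
    simp only [Finset.sum_const, Finset.card_univ, Fintype.card_fin, nsmul_eq_mul, mul_one]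
    linarith
  rw [Finset.sum_eq_zero_iff_of_nonneg fun j _ =>
    sub_nonneg.2 ((Complex.re_le_norm _).trans (norm_star_mul_le_one ha hz j))] at hre
  funext j
  have h1 := eq_one_of_norm_le_of_re_eq (norm_star_mul_le_one ha hz j)
    (by linarith [hre j (Finset.mem_univ j)])
  have h2 : a j * star (a j) = 1 := by
    rw [Complex.star_def, Complex.mul_conj', ha j]
    simp
  calc z j = a j * star (a j) * z j := by rw [h2, one_mul]
    _ = a j := by rw [mul_assoc, h1, mul_one]

theorem eval_peakForm_self {a : Fin n → ℂ} (ha : a ∈ torus n) : eval a (peakForm a) = 1 := by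
  have hn : (n + 1 : ℂ) ≠ 0 := by exact_mod_cast n.succ_ne_zero
  have : ∀ j, star (a j) * a j = 1 := fun j => by
    rw [Complex.star_def, Complex.conj_mul', ha j]
    simp
  rw [eval_peakForm, inv_mul_eq_iff_eq_mul₀ hn]
  simp only [this]
  simp [add_comm]

theorem half_le_re_inv_one_sub {p : ℂ} (hp : ‖p‖ ≤ 1) (h1 : p ≠ 1) : 1 / 2 ≤ ((1 - p)⁻¹).re := by
  have hne : 0 < Complex.normSq (1 - p) := Complex.normSq_pos.2 (sub_ne_zero.2 (Ne.symm h1))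
  have h2 : Complex.normSq p ≤ 1 := by
    rw [Complex.normSq_eq_norm_sq]
    exact pow_le_one₀ (norm_nonneg _) hp
  rw [Complex.inv_re, div_le_div_iff₀ (by norm_num) hne]
  simp only [Complex.normSq_apply, Complex.sub_re, Complex.sub_im, Complex.one_re,
    Complex.one_im] at h2 ⊢
  nlinarith

theorem norm_one_sub_inv_lt {u : ℂ} (hu : 1 / 2 ≤ u.re) : ‖1 - u⁻¹ / 2‖ < 1 := by
  have hne : u ≠ 0 := by
    rintro rfl
    norm_num at hu
  have h : 1 - u⁻¹ / 2 = (2 * u - 1) / (2 * u) := by field_simp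
  rw [h, norm_div, div_lt_one (norm_pos_iff.2 (by simpa using hne))]
  refine lt_of_pow_lt_pow_left₀ 2 (norm_nonneg _) ?_
  rw [← Complex.normSq_eq_norm_sq, ← Complex.normSq_eq_norm_sq]
  simp only [Complex.normSq_apply, Complex.sub_re, Complex.sub_im, Complex.mul_re, Complex.mul_im,
    Complex.one_re, Complex.one_im, Complex.re_ofNat, Complex.im_ofNat]
  nlinarith

/-- Each `𝐬(a)` with `a` in the torus is a peak point of the algebra. With `p_b` the peak form at a
point `b` of the permutation orbit of `a`, each `1 / (1 - p_b)` has real part at least `1 / 2`, hence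
so has their sum `u`; the function `1 - 1 / (2 u)` is symmetric, equals `1` on the orbit, and has
modulus less than `1` elsewhere. As a quotient of symmetric polynomials `P / R` without zeros of the
denominator on the polydisc, `1 / u` descends to a function holomorphic near `Γₙ`. -/
theorem symmetrization_mem_of_isClosedBoundary {E : Set (Fin n → ℂ)}
    (hE : IsClosedBoundary (Gamma n) E) {a : Fin n → ℂ} (ha : a ∈ torus n) :
    symmetrization n a ∈ E := by
  classical
  let O : Finset (Fin n → ℂ) := Finset.univ.image fun e : Equiv.Perm (Fin n) => a ∘ e
  have haO : a ∈ O := Finset.mem_image.2 ⟨1, Finset.mem_univ _, rfl⟩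
  have hOT : ∀ b ∈ O, b ∈ torus n := by
    intro b hb
    obtain ⟨e, -, rfl⟩ := Finset.mem_image.1 hb
    exact fun i => ha (e i)
  have hOsymm : ∀ b ∈ O, symmetrization n b = symmetrization n a := by
    intro b hb
    obtain ⟨e, -, rfl⟩ := Finset.mem_image.1 hb
    exact symmetrization_comp_perm a e
  let P : MvPolynomial (Fin n) ℂ := ∏ b ∈ O, (1 - peakForm b)
  let R : MvPolynomial (Fin n) ℂ := ∑ b ∈ O, ∏ c ∈ O.erase b, (1 - peakForm c)
  have hren : ∀ (e : Equiv.Perm (Fin n)) (b : Fin n → ℂ),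
      rename e (1 - peakForm b) = 1 - peakForm (b ∘ e.symm) := by
    intro e b
    simp only [peakForm, map_sub, map_one, map_mul, map_add, map_sum, rename_C, rename_X]
    congr 3
    exact Fintype.sum_equiv e _ _ fun j => by simp
  have hOe : ∀ (e : Equiv.Perm (Fin n)) (b : Fin n → ℂ), b ∈ O → b ∘ e ∈ O := by
    intro e b hb
    obtain ⟨e', -, rfl⟩ := Finset.mem_image.1 hb
    exact Finset.mem_image.2 ⟨e.trans e', Finset.mem_univ _, rfl⟩
  let act : Equiv.Perm (Fin n) → ((Fin n → ℂ) ≃ (Fin n → ℂ)) := fun e =>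
    Equiv.arrowCongr e (Equiv.refl ℂ)
  -- Permuting the variables permutes the orbit, hence the factors of `P` and the terms of `R`.
  have hOact : ∀ e, O.map (act e).toEmbedding = O := by
    intro e
    refine Finset.eq_of_subset_of_card_le (fun b hb => ?_) (by rw [Finset.card_map])
    obtain ⟨c, hc, rfl⟩ := Finset.mem_map.1 hb
    exact hOe _ c hc
  have hPs : P.IsSymmetric := by
    intro e
    change rename e (∏ b ∈ O, (1 - peakForm b)) = ∏ b ∈ O, (1 - peakForm b)
    rw [map_prod]
    conv_rhs => rw [← hOact e]
    rw [Finset.prod_map]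
    exact Finset.prod_congr rfl fun b _ => hren e b
  have hRs : R.IsSymmetric := by
    intro e
    change rename e (∑ b ∈ O, ∏ c ∈ O.erase b, (1 - peakForm c)) =
      ∑ b ∈ O, ∏ c ∈ O.erase b, (1 - peakForm c)
    rw [map_sum]
    conv_rhs => rw [← hOact e]
    rw [Finset.sum_map]
    refine Finset.sum_congr rfl fun b _ => ?_
    rw [map_prod, ← Finset.map_erase, Finset.prod_map]
    exact Finset.prod_congr rfl fun c _ => hren e c
  obtain ⟨P', hP'⟩ := eval_symmetric_eq hPs
  obtain ⟨R', hR'⟩ := eval_symmetric_eq hRs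
  have hself : ∀ b ∈ O, eval b (peakForm b) = 1 := fun b hb => eval_peakForm_self (hOT b hb)
  have hne1 : ∀ z : Fin n → ℂ, (∀ i, ‖z i‖ ≤ 1) → ∀ b ∈ O, z ≠ b → eval z (peakForm b) ≠ 1 :=
    fun z hz b hb hzb h => hzb (eq_of_eval_peakForm_eq_one (hOT b hb) hz h)
  have hPz : ∀ b ∈ O, eval b P = 0 := by
    intro b hb
    rw [map_prod]
    exact Finset.prod_eq_zero hb (by rw [map_sub, hself b hb, map_one, sub_self])
  have hRb : ∀ b ∈ O, eval b R ≠ 0 := by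
    intro b hb
    rw [map_sum, Finset.sum_eq_single b, map_prod, Finset.prod_ne_zero_iff]
    · intro c hc
      rw [map_sub, map_one, sub_ne_zero]
      exact (hne1 b (fun i => (hOT b hb i).le) c (Finset.mem_of_mem_erase hc)
        (Finset.ne_of_mem_erase hc).symm).symm
    · intro c _ hcb
      rw [map_prod]
      exact Finset.prod_eq_zero (Finset.mem_erase.2 ⟨hcb.symm, hb⟩)
        (by rw [map_sub, hself b hb, map_one, sub_self])
    · exact fun h => absurd hb h
  have hu : ∀ z : Fin n → ℂ, (∀ i, ‖z i‖ ≤ 1) → z ∉ O →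
      ∃ u : ℂ, 1 / 2 ≤ u.re ∧ eval z P ≠ 0 ∧ eval z R = eval z P * u := by
    intro z hz hzO
    have hne : ∀ b ∈ O, 1 - eval z (peakForm b) ≠ 0 := fun b hb =>
      sub_ne_zero.2 (hne1 z hz b hb fun h => hzO (h ▸ hb)).symm
    refine ⟨∑ b ∈ O, (1 - eval z (peakForm b))⁻¹, ?_, ?_, ?_⟩
    · rw [Complex.re_sum]
      have hge : ∀ b ∈ O, 1 / 2 ≤ ((1 - eval z (peakForm b))⁻¹).re := fun b hb =>
        half_le_re_inv_one_sub (norm_eval_peakForm_le_one (hOT b hb) hz)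
          (hne1 z hz b hb fun h => hzO (h ▸ hb))
      exact (hge a haO).trans (Finset.single_le_sum
        (f := fun b => ((1 - eval z (peakForm b))⁻¹).re)
        (fun b hb => (by norm_num : (0 : ℝ) ≤ 1 / 2).trans (hge b hb)) haO)
    · rw [map_prod, Finset.prod_ne_zero_iff]
      intro b hb
      simpa using hne b hb
    · rw [map_sum, Finset.mul_sum]
      refine Finset.sum_congr rfl fun b hb => ?_
      rw [map_prod, map_prod, ← Finset.mul_prod_erase O _ hb, mul_comm, ← mul_assoc]
      simp only [map_sub, map_one]
      rw [inv_mul_cancel₀ (hne b hb), one_mul]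
  have hRne : ∀ s ∈ Gamma n, eval s R' ≠ 0 := by
    rintro _ ⟨z, hz, rfl⟩
    rw [hR']
    by_cases hzO : z ∈ O
    · exact hRb z hzO
    · obtain ⟨u, hu1, hP0, hR⟩ := hu z hz hzO
      rw [hR]
      refine mul_ne_zero hP0 ?_
      rintro rfl
      norm_num at hu1
  let f : (Fin n → ℂ) → ℂ := fun s => 1 - eval s P' / eval s R' / 2
  have hf : InDiscAlgebra (Gamma n) f := by
    have han : ∀ s ∈ Gamma n, AnalyticAt ℂ f s := fun s hs => by
      have h : ∀ q : MvPolynomial (Fin n) ℂ, AnalyticAt ℂ (fun s => eval s q) s := fun q =>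
        AnalyticOnNhd.eval_mvPolynomial q s (Set.mem_univ s)
      exact analyticAt_const.sub (((h P').div (h R') (hRne s hs)).div analyticAt_const two_ne_zero)
    exact ⟨fun s hs => (han s hs).continuousAt.continuousWithinAt,
      fun s hs => han s (interior_subset hs)⟩
  obtain ⟨w, hwE, hw⟩ := hE.2.2 f hf (symmetrization n a)
    ((symmetrization_mem_Gamma_iff a).2 fun i => (ha i).le)
  obtain ⟨z, hz, rfl⟩ := hE.2.1 hwE
  by_cases hzO : z ∈ O
  · rwa [← hOsymm z hzO]
  · exfalso
    obtain ⟨u, hu1, hP0, hR⟩ := hu z hz hzO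
    simp only [f, hP', hR', hPz a haO, hR] at hw
    rw [div_mul_cancel_left₀ hP0] at hw
    have := norm_one_sub_inv_lt hu1
    simp at hw
    linarith

/-- The distinguished boundary of the symmetrized polydisc is the symmetrization of the torus. -/
theorem distinguishedBoundary_eq : distinguishedBoundary n = symmetrization n '' torus n := by
  refine Set.Subset.antisymm (Set.sInter_subset_of_mem torus_image_isClosedBoundary) ?_
  rintro _ ⟨a, ha, rfl⟩ E hE
  exact symmetrization_mem_of_isClosedBoundary hE ha

end Peak

/-! ### Self-inversive polynomials and polynomial convexity -/

section SelfInversive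

open Polynomial ComplexConjugate

variable {m : ℕ}

theorem symmetrization_last (z : Fin (m + 1) → ℂ) :
    symmetrization (m + 1) z (Fin.last m) = ∏ j, z j := by
  rw [← coeff_rootPoly (symmetrization (m + 1) z), rootPoly_symmetrization]
  simp [coeff_zero_eq_eval_zero, eval_prod]

theorem eval_rootPoly_succ (s : Fin (m + 1) → ℂ) (t : ℂ) :
    (rootPoly s).eval t =
      t ^ (m + 1) + ∑ i : Fin m, s i.castSucc * t ^ (m - i) + s (Fin.last m) := by
  rw [eval_rootPoly, Fin.sum_univ_castSucc]
  simp [add_assoc]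

theorem prod_one_add_conj_mul {n : ℕ} (z : Fin n → ℂ) (t : ℂ) :
    ∏ j, (1 + conj (z j) * t) = 1 + ∑ i, conj (symmetrization n z i) * t ^ (i + 1 : ℕ) := by
  have := congrArg conj (prod_one_add_mul z (conj t))
  simpa using this

theorem sum_rev_mul_pow (a : Fin m → ℂ) (t : ℂ) :
    ∑ i, a i * t ^ (i + 1 : ℕ) = ∑ i : Fin m, a i.rev * t ^ (m - i) := by
  rw [← Equiv.sum_comp Fin.revPerm]
  refine Finset.sum_congr rfl fun i _ => ?_
  rw [Fin.revPerm_apply, Fin.val_rev]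
  congr 2
  omega

/-- `𝐬(w)` is self-inversive for `w` in the torus: `∏ (t + wⱼ) = (∏ wⱼ) ∏ (1 + w̄ⱼ t)`. -/
theorem conj_symmetrization_last_mul {w : Fin (m + 1) → ℂ} (hw : w ∈ torus (m + 1)) (i : Fin m) :
    conj (symmetrization (m + 1) w (Fin.last m)) * symmetrization (m + 1) w i.castSucc =
      conj (symmetrization (m + 1) w i.rev.castSucc) := by
  set s := symmetrization (m + 1) w with hs
  have hunit : s (Fin.last m) * conj (s (Fin.last m)) = 1 := by
    rw [Complex.mul_conj', hs, symmetrization_last, norm_prod,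
      Finset.prod_congr rfl fun j _ => hw j]
    simp
  let s' : Fin (m + 1) → ℂ :=
    Fin.snoc (fun i : Fin m => s (Fin.last m) * conj (s i.rev.castSucc)) (s (Fin.last m))
  have hs' : rootPoly s' = ∏ j, (X + C (w j)) := by
    refine Polynomial.funext fun t => ?_
    have h1 : ∏ j, (t + w j) = s (Fin.last m) * ∏ j, (1 + conj (w j) * t) := by
      rw [hs, symmetrization_last, ← Finset.prod_mul_distrib]
      refine Finset.prod_congr rfl fun j _ => ?_
      rw [mul_add, ← mul_assoc, Complex.mul_conj', hw j]
      simp [add_comm]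
    have h2 : (∏ j, (X + C (w j))).eval t = ∏ j, (t + w j) := by
      rw [eval_prod]
      simp
    rw [h2, h1, eval_rootPoly_succ, prod_one_add_conj_mul, Fin.sum_univ_castSucc]
    simp only [Fin.val_castSucc, Fin.val_last, s', Fin.snoc_castSucc, Fin.snoc_last]
    rw [sum_rev_mul_pow (fun i => conj (symmetrization (m + 1) w i.castSucc)), ← hs,
      mul_add, mul_add, Finset.mul_sum, ← mul_assoc, hunit]
    simp only [mul_assoc]
    ring
  have hss := congrFun ((symmetrization_eq_iff w s').2 hs') i.castSucc
  simp only [s', Fin.snoc_castSucc] at hss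
  rw [← hs] at hss
  rw [hss, ← mul_assoc, mul_comm (conj _), hunit, one_mul]

/-- The tuple `(γ₁ s₁, …, γₙ₋₁ sₙ₋₁)` with `n = m + 1` and `γᵢ = (n - i) / n`: the coefficients of the
derivative of `rootPoly s`, made monic. -/
noncomputable def gammaScale (s : Fin (m + 1) → ℂ) : Fin m → ℂ :=
  fun i => (((m + 1 : ℂ) - (i + 1)) / (m + 1)) * s i.castSucc

theorem derivative_rootPoly (s : Fin (m + 1) → ℂ) :
    derivative (rootPoly s) = C (m + 1 : ℂ) * rootPoly (gammaScale s) := by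
  have hm : (m + 1 : ℂ) ≠ 0 := by exact_mod_cast m.succ_ne_zero
  rw [rootPoly, rootPoly, derivative_add, derivative_X_pow, derivative_sum, mul_add,
    Fin.sum_univ_castSucc, Finset.mul_sum]
  simp only [derivative_C_mul_X_pow, Fin.val_castSucc, Fin.val_last, Nat.add_sub_cancel,
    Nat.sub_self, Nat.cast_zero, mul_zero, map_zero, zero_mul, add_zero]
  congr 1
  · simp
  · refine Finset.sum_congr rfl fun i _ => ?_
    rw [← mul_assoc, ← C_mul, gammaScale, Nat.cast_sub i.2.le,
      show m - (i : ℕ) - 1 = m - 1 - i by omega]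
    congr 2
    field_simp
    ring

/-- By the Gauss–Lucas theorem the derivative of `rootPoly s` has its roots in the closed disc. -/
theorem gammaScale_mem_Gamma {s : Fin (m + 1) → ℂ} (hs : s ∈ Gamma (m + 1)) :
    gammaScale s ∈ Gamma m := by
  obtain ⟨z, hz, rfl⟩ := hs
  obtain ⟨y, hy⟩ := symmetrization_surjective (gammaScale (symmetrization (m + 1) z))
  rw [← hy, symmetrization_mem_Gamma_iff]
  intro i
  have hm : (m + 1 : ℂ) ≠ 0 := by exact_mod_cast m.succ_ne_zero
  set P := rootPoly (symmetrization (m + 1) z) with hP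
  have hder : derivative P = C (m + 1 : ℂ) * rootPoly (symmetrization m y) := by
    rw [hP, derivative_rootPoly, hy]
  have hmem : -y i ∈ P.derivative.rootSet ℂ := by
    rw [mem_rootSet, hder]
    refine ⟨mul_ne_zero (C_ne_zero.2 hm) (monic_rootPoly _).ne_zero, ?_⟩
    rw [coe_aeval_eq_eval, eval_mul, eval_rootPoly_symmetrization,
      Finset.prod_eq_zero (f := fun j => -y i + y j) (Finset.mem_univ i) (neg_add_cancel _),
      mul_zero]
  have hdeg : 0 < P.degree := by
    rw [← natDegree_pos_iff_degree_pos, hP, natDegree_rootPoly]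
    exact m.succ_pos
  have hsub : P.rootSet ℂ ⊆ Metric.closedBall 0 1 := by
    intro t ht
    have h := (mem_rootSet.1 ht).2
    rw [coe_aeval_eq_eval, hP, eval_rootPoly_symmetrization, Finset.prod_eq_zero_iff] at h
    obtain ⟨j, -, hj⟩ := h
    rw [eq_neg_of_add_eq_zero_left hj]
    simpa using hz j
  have := convexHull_min hsub (convex_closedBall 0 1)
    (rootSet_derivative_subset_convexHull_rootSet hdeg hmem)
  simpa using this

theorem norm_one_add_conj_mul_le {y t : ℂ} (hy : ‖y‖ ≤ 1) (ht : 1 ≤ ‖t‖) :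
    ‖1 + conj y * t‖ ≤ ‖t + y‖ := by
  refine le_of_sq_le_sq ?_ (norm_nonneg _)
  have h1 : Complex.normSq y ≤ 1 := by
    rw [Complex.normSq_eq_norm_sq]
    exact pow_le_one₀ (norm_nonneg _) hy
  have h2 : 1 ≤ Complex.normSq t := by
    rw [Complex.normSq_eq_norm_sq]
    exact one_le_pow₀ ht
  rw [← Complex.normSq_eq_norm_sq, ← Complex.normSq_eq_norm_sq]
  simp only [Complex.normSq_apply, Complex.add_re, Complex.add_im, Complex.mul_re, Complex.mul_im,
    Complex.one_re, Complex.one_im, Complex.conj_re, Complex.conj_im] at h1 h2 ⊢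
  nlinarith [mul_nonneg (sub_nonneg.2 h1) (sub_nonneg.2 h2)]

/-- Euler's identity for a self-inversive polynomial `P` of degree `n`: both `t P'(t) / n` and
`P(t) - t P'(t) / n` are expressed through the roots of `P'`. -/
theorem eval_rootPoly_selfInversive {s : Fin (m + 1) → ℂ} {y : Fin m → ℂ}
    (hlast : ‖s (Fin.last m)‖ = 1)
    (hinv : ∀ i : Fin m, conj (s (Fin.last m)) * s i.castSucc = conj (s i.rev.castSucc))
    (hy : symmetrization m y = gammaScale s) (t : ℂ) :
    (rootPoly s).eval t = t * ∏ j, (t + y j) + s (Fin.last m) * ∏ j, (1 + conj (y j) * t) := by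
  have hm : (m + 1 : ℂ) ≠ 0 := by exact_mod_cast m.succ_ne_zero
  have hunit : s (Fin.last m) * conj (s (Fin.last m)) = 1 := by
    rw [Complex.mul_conj', hlast]
    simp
  rw [eval_rootPoly_succ, ← eval_rootPoly_symmetrization, eval_rootPoly, prod_one_add_conj_mul,
    sum_rev_mul_pow, hy, mul_add, mul_add, mul_one, Finset.mul_sum, Finset.mul_sum, pow_succ',
    add_assoc, add_assoc]
  congr 1
  rw [add_comm, add_left_comm, ← Finset.sum_add_distrib]
  congr 1
  refine Finset.sum_congr rfl fun i _ => ?_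
  have h1 : t ^ (m - i : ℕ) = t * t ^ (m - 1 - i) := by
    rw [← pow_succ']
    congr 1
    omega
  have h2 : s (Fin.last m) * conj (s i.rev.castSucc) = s i.castSucc := by
    rw [← hinv, ← mul_assoc, hunit, one_mul]
  have h3 : ((i.rev : ℕ) : ℂ) = m - (i + 1) := by
    rw [Fin.val_rev, Nat.cast_sub (by omega)]
    push_cast
    ring
  have h4 : conj (gammaScale s i.rev) = ((i + 1 : ℂ) / (m + 1)) * conj (s i.rev.castSucc) := by
    rw [gammaScale, map_mul, h3]
    congr 1
    simp
  rw [h4, gammaScale, h1]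
  -- The two factors `γ` belonging to complementary indices add up to `1`.
  calc _ = ((m + 1 - (i + 1)) / (m + 1) + (i + 1) / (m + 1) : ℂ) * s i.castSucc *
        (t * t ^ (m - 1 - i)) := by
        rw [← add_div, sub_add_cancel, div_self hm, one_mul]
    _ = _ := by
      linear_combination -((i + 1 : ℂ) / (m + 1)) * (t * t ^ (m - 1 - (i : ℕ))) * h2

/-- Cohn's theorem: a self-inversive polynomial whose derivative has its roots in the closed disc has
its roots on the circle. At a root `t` with `|t| > 1` the two terms of
`eval_rootPoly_selfInversive` cancel, although the first is the larger one in modulus; and roots in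
the closed disc with product of modulus `1` are unimodular. -/
theorem mem_image_torus_of_selfInversive {s : Fin (m + 1) → ℂ}
    (hlast : ‖s (Fin.last m)‖ = 1)
    (hinv : ∀ i : Fin m, conj (s (Fin.last m)) * s i.castSucc = conj (s i.rev.castSucc))
    (hs : gammaScale s ∈ Gamma m) : s ∈ symmetrization (m + 1) '' torus (m + 1) := by
  obtain ⟨z, rfl⟩ := symmetrization_surjective s
  obtain ⟨y, hy, hys⟩ := hs
  have hz : ∀ j, ‖z j‖ ≤ 1 := by
    intro j
    by_contra! hj
    have h := eval_rootPoly_selfInversive hlast hinv hys (-z j)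
    rw [eval_rootPoly_symmetrization,
      Finset.prod_eq_zero (f := fun i => -z j + z i) (Finset.mem_univ j) (neg_add_cancel _)] at h
    have h1 := congrArg norm (eq_neg_of_add_eq_zero_left h.symm)
    rw [norm_neg, norm_mul, norm_mul, hlast, one_mul, norm_neg, norm_prod, norm_prod] at h1
    have h2 : ∏ i, ‖1 + conj (y i) * -z j‖ ≤ ∏ i, ‖-z j + y i‖ :=
      Finset.prod_le_prod (fun _ _ => norm_nonneg _) fun i _ =>
        norm_one_add_conj_mul_le (hy i) (by rw [norm_neg]; exact hj.le)
    have h3 : 0 < ∏ i, ‖-z j + y i‖ := Finset.prod_pos fun i _ => by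
      refine norm_pos_iff.2 fun h0 => ?_
      have : z j = y i := by linear_combination -h0
      rw [this] at hj
      exact absurd (hy i) (not_le.2 hj)
    nlinarith
  refine ⟨z, fun j => le_antisymm (hz j) ?_, rfl⟩
  rw [symmetrization_last, norm_prod, ← Finset.mul_prod_erase _ _ (Finset.mem_univ j)] at hlast
  calc (1 : ℝ) = ‖z j‖ * ∏ i ∈ Finset.univ.erase j, ‖z i‖ := hlast.symm
    _ ≤ ‖z j‖ := mul_le_of_le_one_right (norm_nonneg _)
      (Finset.prod_le_one (fun _ _ => norm_nonneg _) fun i _ => hz i)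

end SelfInversive

section PolynomialConvexity

open Polynomial

variable {n : ℕ}

theorem norm_eval_le_sSup {s : Fin n → ℂ} (hs : s ∈ Gamma n) (p : MvPolynomial (Fin n) ℂ) :
    ‖MvPolynomial.eval s p‖ ≤ sSup ((fun z => ‖MvPolynomial.eval z p‖) '' Gamma n) :=
  le_csSup (isCompact_Gamma.image (MvPolynomial.continuous_eval p).norm).bddAbove ⟨s, hs, rfl⟩

/-- `Γₙ` is polynomially convex. If `|zⱼ| > 1` and `r` vanishes at the `zᵢ ≠ zⱼ` but not at `zⱼ`, the
symmetric polynomials `∑ zᵢᴺ r(zᵢ)` are bounded on `Γₙ` uniformly in `N`, and unbounded at `𝐬(z)`. -/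
theorem mem_Gamma_of_norm_eval_le {s : Fin n → ℂ}
    (hs : ∀ p : MvPolynomial (Fin n) ℂ,
      ‖MvPolynomial.eval s p‖ ≤ sSup ((fun z => ‖MvPolynomial.eval z p‖) '' Gamma n)) :
    s ∈ Gamma n := by
  classical
  obtain ⟨z, rfl⟩ := symmetrization_surjective s
  refine (symmetrization_mem_Gamma_iff z).2 fun j => ?_
  by_contra! hj
  let r : ℂ[X] := ∏ ζ ∈ (Finset.univ.image z).erase (z j), (X - C ζ)
  have hr0 : ∀ i, z i ≠ z j → r.eval (z i) = 0 := fun i hi => by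
    rw [eval_prod]
    exact Finset.prod_eq_zero (Finset.mem_erase.2 ⟨hi, Finset.mem_image_of_mem _
      (Finset.mem_univ i)⟩) (by simp)
  have hrj : r.eval (z j) ≠ 0 := by
    rw [eval_prod, Finset.prod_ne_zero_iff]
    intro ζ hζ
    rw [eval_sub, eval_X, eval_C, sub_ne_zero]
    exact (Finset.ne_of_mem_erase hζ).symm
  obtain ⟨B, hB⟩ := (isCompact_closedBall (0 : ℂ) 1).exists_bound_of_continuousOn
    r.continuous.continuousOn
  have key : ∀ N : ℕ, ‖z j‖ ^ N * ‖r.eval (z j)‖ ≤ n * B := by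
    intro N
    let p : MvPolynomial (Fin n) ℂ := ∑ i, MvPolynomial.X i ^ N * aeval (MvPolynomial.X i) r
    have hp : ∀ v : Fin n → ℂ, MvPolynomial.eval v p = ∑ i, v i ^ N * r.eval (v i) := by
      intro v
      rw [map_sum]
      refine Finset.sum_congr rfl fun i _ => ?_
      rw [map_mul, map_pow, MvPolynomial.eval_X, ← MvPolynomial.aeval_eq_eval,
        ← Polynomial.aeval_algHom_apply, MvPolynomial.aeval_X, coe_aeval_eq_eval]
    have hps : p.IsSymmetric := by
      intro e
      rw [map_sum]
      refine Fintype.sum_equiv e _ _ fun i => ?_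
      rw [map_mul, map_pow, ← Polynomial.aeval_algHom_apply, MvPolynomial.rename_X]
    obtain ⟨q, hq⟩ := eval_symmetric_eq hps
    have h1 : ‖MvPolynomial.eval (symmetrization n z) q‖ ≤ n * B := by
      refine (hs q).trans (csSup_le (Set.Nonempty.image _ ⟨symmetrization n 0, 0, by simp, rfl⟩) ?_)
      rintro _ ⟨_, ⟨w, hw, rfl⟩, rfl⟩
      simp only [hq, hp]
      refine (norm_sum_le_of_le (n := fun _ => B) _ fun i _ => ?_).trans (by simp)
      rw [norm_mul, norm_pow]
      have hBi := hB (w i) (by simpa using hw i)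
      calc ‖w i‖ ^ N * ‖r.eval (w i)‖ ≤ 1 * ‖r.eval (w i)‖ := by
            gcongr
            exact pow_le_one₀ (norm_nonneg _) (hw i)
        _ ≤ B := by rwa [one_mul]
    rw [hq, hp] at h1
    have h2 : ∑ i, z i ^ N * r.eval (z i) =
        (Finset.univ.filter fun i => z i = z j).card * (z j ^ N * r.eval (z j)) := by
      rw [← nsmul_eq_mul, ← Finset.sum_const, Finset.sum_filter]
      refine Finset.sum_congr rfl fun i _ => ?_
      split_ifs with h
      · rw [h]
      · rw [hr0 i h, mul_zero]
    rw [h2, norm_mul, Complex.norm_natCast, norm_mul, norm_pow] at h1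
    refine le_trans (le_mul_of_one_le_left (by positivity) ?_) h1
    exact Nat.one_le_cast.2 (Finset.card_pos.2 ⟨j, by simp⟩)
  obtain ⟨N, hN⟩ := pow_unbounded_of_one_lt (n * B / ‖r.eval (z j)‖) hj
  rw [div_lt_iff₀ (norm_pos_iff.2 hrj)] at hN
  exact absurd (key N) (not_le.2 hN)

end PolynomialConvexity

/-! ### The three characterizations in a functional model -/

section Lifting

universe u

/-- Stonean spaces are projective (Gleason), so a continuous map into `𝐬(𝕋ⁿ)` lifts through `𝐬`. -/
theorem exists_torus_lift {Ω : Type u} [TopologicalSpace Ω] [CompactSpace Ω] [T2Space Ω]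
    [ExtremallyDisconnected Ω] {n : ℕ} (f : Fin n → C(Ω, ℂ))
    (hf : ∀ x, (fun i => f i x) ∈ symmetrization n '' torus n) :
    ∃ w : Fin n → C(Ω, ℂ), ∀ x, (fun i => w i x) ∈ torus n ∧
      symmetrization n (fun i => w i x) = fun i => f i x := by
  have : CompactSpace (torus n) := isCompact_iff_compactSpace.1 isCompact_torus
  have : CompactSpace (symmetrization n '' torus n) :=
    isCompact_iff_compactSpace.1 (isCompact_torus.image continuous_symmetrization)
  let F : Ω → ULift.{u} (symmetrization n '' torus n) := fun x => ⟨⟨fun i => f i x, hf x⟩⟩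
  let G : ULift.{u} (torus n) → ULift.{u} (symmetrization n '' torus n) := fun z =>
    ⟨⟨symmetrization n z.down, z.down, z.down.2, rfl⟩⟩
  have hF : Continuous F := continuous_uliftUp.comp
    (Continuous.subtype_mk (continuous_pi fun i => (f i).continuous) _)
  have hG : Continuous G := continuous_uliftUp.comp (Continuous.subtype_mk
    (continuous_symmetrization.comp (continuous_subtype_val.comp continuous_uliftDown)) _)
  have hGs : Function.Surjective G := by
    rintro ⟨⟨_, z, hz, rfl⟩⟩
    exact ⟨⟨⟨z, hz⟩⟩, rfl⟩
  obtain ⟨h, hh, hGh⟩ := CompactT2.ExtremallyDisconnected.projective hF hG hGs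
  refine ⟨fun i => ⟨fun x => (h x).down.1 i, (continuous_apply i).comp
    (continuous_subtype_val.comp (continuous_uliftDown.comp hh))⟩, fun x => ⟨(h x).down.2, ?_⟩⟩
  exact congrArg (fun y => y.down.1) (congrFun hGh x)

end Lifting

section Conditions

variable {H : Type*} [NormedAddCommGroup H] [InnerProductSpace ℂ H] [CompleteSpace H] {m : ℕ}

open ComplexConjugate

theorem star_mul_self_eq_one_iff {Ω : Type*} [TopologicalSpace Ω] {g : C(Ω, ℂ)} :
    star g * g = 1 ↔ ∀ x, ‖g x‖ = 1 := by
  rw [ContinuousMap.ext_iff]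
  refine forall_congr' fun x => ?_
  change conj (g x) * g x = 1 ↔ _
  rw [Complex.conj_mul']
  norm_cast
  exact pow_eq_one_iff_of_nonneg (norm_nonneg _) two_ne_zero

/-- Here `Sⱼ* = Sₙ* Sₙ₋ⱼ`, and `Sᵢ` commutes with the inverse `Sₙ*` of `Sₙ`. -/
theorem commute_star_of_selfInversive {S : Fin (m + 1) → H →L[ℂ] H}
    (hS : ∀ i j, Commute (S i) (S j))
    (hlast : star (S (Fin.last m)) * S (Fin.last m) = 1 ∧
      S (Fin.last m) * star (S (Fin.last m)) = 1)
    (hinv : ∀ i : Fin m, star (S (Fin.last m)) * S i.castSucc = star (S i.rev.castSucc))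
    (i j : Fin (m + 1)) : Commute (S i) (star (S j)) := by
  have hu : Commute (S i) (star (S (Fin.last m))) :=
    IsStarNormal.commute_star_right ⟨hlast.1.trans hlast.2.symm⟩ (hS i _)
  induction j using Fin.lastCases with
  | last => exact hu
  | cast j =>
    have := hinv j.rev
    rw [Fin.rev_rev] at this
    rw [← this]
    exact hu.mul_right (hS i _)

variable {Ω : Type*} [TopologicalSpace Ω] [CompactSpace Ω]

theorem injective_of_norm_eq {Φ : C(Ω, ℂ) →⋆ₐ[ℂ] (H →L[ℂ] H)} (hΦ : ∀ g, ‖Φ g‖ = ‖g‖) :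
    Function.Injective Φ := fun a b h => by
  rw [← sub_eq_zero, ← norm_eq_zero, ← hΦ, map_sub, h, sub_self, norm_zero]

/-- In a functional model, `p(γ₁ S₁, …, γₙ₋₁ Sₙ₋₁)` has the norm of the function
`x ↦ p(gammaScale (f x))`. -/
theorem norm_polyEval_gammaScale (Φ : C(Ω, ℂ) →⋆ₐ[ℂ] (H →L[ℂ] H)) (hΦ : ∀ g, ‖Φ g‖ = ‖g‖)
    (f : Fin (m + 1) → C(Ω, ℂ)) (p : MvPolynomial (Fin m) ℂ) :
    ∃ g : C(Ω, ℂ), (∀ x, g x = MvPolynomial.eval (gammaScale fun i => f i x) p) ∧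
      ‖polyEval (fun i : Fin m => (((m + 1 : ℂ) - (i + 1)) / (m + 1)) • Φ (f i.castSucc)) p‖ =
        ‖g‖ := by
  refine ⟨MvPolynomial.aeval
    (fun i : Fin m => (((m + 1 : ℂ) - (i + 1)) / (m + 1)) • f i.castSucc) p, fun x => ?_, ?_⟩
  · rw [aeval_continuousMap_apply]
    rfl
  · simp only [← map_smul]
    rw [← hΦ]
    exact congrArg norm (polyEval_map (Φ : C(Ω, ℂ) →ₐ[ℂ] (H →L[ℂ] H)) _ p)

theorem exists_unitary_of_isGammaUnitary {n : ℕ} {S : Fin n → H →L[ℂ] H} (h : IsGammaUnitary S) :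
    ∃ U : Fin n → H →L[ℂ] H, (∀ i, U i ∈ unitary (H →L[ℂ] H)) ∧ (∀ i j, Commute (U i) (U j)) ∧
      ∀ i, S i = polyEval U (MvPolynomial.esymm (Fin n) ℂ (i + 1)) := by
  obtain ⟨hcomm, hnormal, hspec⟩ := h
  obtain ⟨Ω, _, _, _, _, Φ, f, hΦ, hf⟩ := exists_extremallyDisconnected_model S hcomm
    fun i j => (hnormal j).commute_star_right (hcomm i j)
  obtain rfl : (fun i => Φ (f i)) = S := funext hf
  rw [jointSpectrum_eq_range Φ hΦ, distinguishedBoundary_eq] at hspec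
  obtain ⟨w, hw⟩ := exists_torus_lift f fun x => hspec ⟨x, rfl⟩
  refine ⟨fun i => Φ (w i), fun i => ?_, fun i j => ?_, fun i => ?_⟩
  · have h1 : star (w i) * w i = 1 := star_mul_self_eq_one_iff.2 fun x => (hw x).1 i
    rw [Unitary.mem_iff, ← map_star, ← map_mul, ← map_mul, mul_comm (w i), h1, map_one]
    exact ⟨rfl, rfl⟩
  · rw [commute_iff_eq, ← map_mul, ← map_mul, mul_comm]
  · refine Eq.trans ?_ (polyEval_map (Φ : C(Ω, ℂ) →ₐ[ℂ] (H →L[ℂ] H)) w _).symm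
    refine congrArg Φ (ContinuousMap.ext fun x => ?_)
    rw [aeval_continuousMap_apply]
    exact (congrFun (hw x).2 i).symm

theorem conditions_of_exists_unitary {S U : Fin (m + 1) → H →L[ℂ] H}
    (hU : ∀ i, U i ∈ unitary (H →L[ℂ] H)) (hcomm : ∀ i j, Commute (U i) (U j))
    (hSU : ∀ i, S i = polyEval U (MvPolynomial.esymm (Fin (m + 1)) ℂ (i + 1))) :
    (star (S (Fin.last m)) * S (Fin.last m) = 1 ∧ S (Fin.last m) * star (S (Fin.last m)) = 1) ∧
      (∀ i : Fin m, star (S (Fin.last m)) * S i.castSucc = star (S i.rev.castSucc)) ∧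
      IsGammaContraction
        (fun i : Fin m => (((m + 1 : ℂ) - (i + 1)) / (m + 1)) • S i.castSucc) := by
  obtain ⟨Ω, _, _, _, _, Φ, w, hΦ, hw⟩ := exists_extremallyDisconnected_model U hcomm fun i j =>
    IsStarNormal.commute_star_right
      ⟨(Unitary.mem_iff.1 (hU j)).1.trans (Unitary.mem_iff.1 (hU j)).2.symm⟩ (hcomm i j)
  obtain rfl : (fun i => Φ (w i)) = U := funext hw
  have hwT : ∀ x, (fun i => w i x) ∈ torus (m + 1) := fun x i => by
    have h1 := (Unitary.mem_iff.1 (hU i)).1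
    rw [← map_star, ← map_mul, ← map_one Φ] at h1
    exact star_mul_self_eq_one_iff.1 (injective_of_norm_eq hΦ h1) x
  obtain ⟨f, hfx, hf⟩ : ∃ f : Fin (m + 1) → C(Ω, ℂ),
      (∀ x, (fun i => f i x) = symmetrization (m + 1) fun i => w i x) ∧ ∀ i, S i = Φ (f i) :=
    ⟨fun i => MvPolynomial.aeval w (MvPolynomial.esymm (Fin (m + 1)) ℂ (i + 1)),
      fun x => funext fun i => aeval_continuousMap_apply w _ x,
      fun i => (hSU i).trans (polyEval_map (Φ : C(Ω, ℂ) →ₐ[ℂ] (H →L[ℂ] H)) w _)⟩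
  obtain rfl : S = fun i => Φ (f i) := funext hf
  have hlast : star (f (Fin.last m)) * f (Fin.last m) = 1 := by
    refine star_mul_self_eq_one_iff.2 fun x => ?_
    rw [congrFun (hfx x) (Fin.last m), symmetrization_last, norm_prod]
    exact Finset.prod_eq_one fun i _ => hwT x i
  refine ⟨?_, fun i => ?_, fun i j => ?_, fun p => ?_⟩
  · rw [← map_star, ← map_mul, ← map_mul, mul_comm (f _), hlast, map_one]
    exact ⟨rfl, rfl⟩
  · rw [← map_star, ← map_mul, ← map_star]
    refine congrArg Φ (ContinuousMap.ext fun x => ?_)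
    change conj (f _ x) * f _ x = conj (f _ x)
    rw [congrFun (hfx x), congrFun (hfx x), congrFun (hfx x)]
    exact conj_symmetrization_last_mul (hwT x) i
  · refine Commute.smul_left (Commute.smul_right ?_ _) _
    rw [commute_iff_eq, ← map_mul, ← map_mul, mul_comm]
  · obtain ⟨g, hg, hnorm⟩ := norm_polyEval_gammaScale Φ hΦ f p
    rw [hnorm]
    refine (ContinuousMap.norm_le _ (Real.sSup_nonneg ?_)).2 fun x => ?_
    · rintro _ ⟨z, -, rfl⟩
      exact norm_nonneg _
    · rw [hg, hfx]
      exact norm_eval_le_sSup (gammaScale_mem_Gamma ⟨_, fun i => (hwT x i).le, rfl⟩) p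

theorem isGammaUnitary_of_conditions {S : Fin (m + 1) → H →L[ℂ] H}
    (hS : ∀ i j, Commute (S i) (S j))
    (hlast : star (S (Fin.last m)) * S (Fin.last m) = 1 ∧
      S (Fin.last m) * star (S (Fin.last m)) = 1)
    (hinv : ∀ i : Fin m, star (S (Fin.last m)) * S i.castSucc = star (S i.rev.castSucc))
    (hγ : IsGammaContraction
      (fun i : Fin m => (((m + 1 : ℂ) - (i + 1)) / (m + 1)) • S i.castSucc)) :
    IsGammaUnitary S := by
  have hstar := commute_star_of_selfInversive hS hlast hinv
  refine ⟨hS, fun i => ⟨(hstar i i).symm⟩, ?_⟩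
  obtain ⟨Ω, _, _, _, _, Φ, f, hΦ, hf⟩ := exists_extremallyDisconnected_model S hS hstar
  obtain rfl : (fun i => Φ (f i)) = S := funext hf
  rw [jointSpectrum_eq_range Φ hΦ, distinguishedBoundary_eq]
  rintro _ ⟨x, rfl⟩
  refine mem_image_torus_of_selfInversive ?_ (fun i => ?_) (mem_Gamma_of_norm_eval_le fun p => ?_)
  · have h1 := hlast.1
    rw [← map_star, ← map_mul, ← map_one Φ] at h1
    exact star_mul_self_eq_one_iff.1 (injective_of_norm_eq hΦ h1) x
  · have h1 := hinv i
    rw [← map_star, ← map_mul, ← map_star] at h1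
    exact congrArg (fun g : C(Ω, ℂ) => g x) (injective_of_norm_eq hΦ h1)
  · obtain ⟨g, hg, hnorm⟩ := norm_polyEval_gammaScale Φ hΦ f p
    rw [← hg]
    exact (g.norm_coe_le_norm x).trans (hnorm.symm.le.trans (hγ.2 p))

end Conditions

end GammaN

/-- The tuple `(S₁, …, Sₙ)` with `n = m + 1 ≥ 1`; the entry `S i` is `S_{i+1}`. Thus `S (Fin.last m)` is
`Sₙ`, and for `i : Fin m` the entries `S i.castSucc` and `S i.rev.castSucc` are `S_{i+1}` and
`S_{n-(i+1)}`, while `γ_{i+1} = (n - (i + 1)) / n`. -/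
theorem mainTheorem2 {H : Type*} [NormedAddCommGroup H] [InnerProductSpace ℂ H] [CompleteSpace H]
    (m : ℕ) (S : Fin (m + 1) → H →L[ℂ] H) (hS : ∀ i j, Commute (S i) (S j)) :
    List.TFAE
      [GammaN.IsGammaUnitary S,
       (star (S (Fin.last m)) * S (Fin.last m) = 1 ∧ S (Fin.last m) * star (S (Fin.last m)) = 1) ∧
         (∀ i : Fin m, star (S (Fin.last m)) * S i.castSucc = star (S i.rev.castSucc)) ∧
         GammaN.IsGammaContraction
           (fun i : Fin m => (((m + 1 : ℂ) - (i + 1)) / (m + 1)) • S i.castSucc),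
       ∃ U : Fin (m + 1) → H →L[ℂ] H,
         (∀ i, U i ∈ unitary (H →L[ℂ] H)) ∧ (∀ i j, Commute (U i) (U j)) ∧
           ∀ i, S i = GammaN.polyEval U (MvPolynomial.esymm (Fin (m + 1)) ℂ (i + 1))] := by
  tfae_have 1 → 3 := GammaN.exists_unitary_of_isGammaUnitary
  tfae_have 3 → 2 := fun ⟨_, hU, hcomm, hSU⟩ => GammaN.conditions_of_exists_unitary hU hcomm hSU
  tfae_have 2 → 1 := fun ⟨hlast, hinv, hγ⟩ =>
    GammaN.isGammaUnitary_of_conditions hS hlast hinv hγ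
  tfae_finish
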